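/- **Setting.** Let $\Omega$ be the set of causal sets on the labels $0,1,2,\dots$ that are naturally labelled: strict partial orders $\prec$ on $\mathbb N$ such that $i\prec j$ implies $i<j$ (so every element has a finite past). Let $\Omega_n$ be the finite set of naturally labelled causal sets $c_n$ on the labels $0,\dots,n-1$. For $c_n\in\Omega_n$ let $\mathrm{cyl}(c_n)\subseteq\Omega$ be the set of all $c\in\Omega$ whose restriction $c|_n$ to the first $n$ labels is $c_n$, and let $\mathfrak Z$ be the algebra of subsets of $\Omega$ generated by all cylinder sets. Given couplings $t_0,t_1,\dots\in\mathbb C$, put $\lambda(a,b)=\sum_{k=b}^{a}\binom{a-b}{k-b}t_k$, and suppose that $\lambda(n,0)\neq0$ for all $n\ge 0$. A transition $c_n\to c_{n+1}$ adds a new element $n$ to $c_n=c_{n+1}|_n$; its amplitude is $A(c_n\to c_{n+1})=\lambda(\varpi,m')/\lambda(n,0)$, where $\varpi$ is the number of elements in the past of the new element and $m'$ is the number of maximal elements of that past. The complex sequential growth ($\mathbb C$SG) dynamics with couplings $(t_k)$ is the finitely additive measure $\mu:\mathfrak Z\to\mathbb C$ with $\mu(\mathrm{cyl}(c_n))=\prod_{r=1}^{n-1}A(c_n|_r\to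 c_n|_{r+1})$. It is of bounded variation if $$|\mu|(\Omega)=\sup_\pi\sum_{\alpha\in\pi}|\mu(\alpha)|<\infty ,$$ where $\pi$ runs over the finite partitions of $\Omega$ into members of $\mathfrak Z$. **Claim.** Let $m\ge0$ and $0=k_0<k_1<\dots<k_m$, suppose that $t_{k_0},t_{k_1},\dots,t_{k_m}$ are nonzero and that all other $t_k$ vanish, and suppose that $\lambda(n,0)\ne0$ for all $n$. Write $\mathbb R^+=(0,\infty)$. The $\mathbb C$SG dynamics is of bounded variation if any one of the following is true: 1. $t_{k_i}\in\mathbb R^+$ for all $i\in\{0,\dots,m\}$; 2. $m=1$ and $k_1>1$; 3. $m>1$ and $k_m-k_{m-1}>1$. It is not of bounded variation if $m=1$, $k_1=1$ and $t_1/t_0\notin\mathbb R^+$ (with the usual normalisation $t_0=1$ this reads $t_1\notin\mathbb R^+$). -/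

import Mathlib

namespace CSG

/-- A finite labelled causal set with `n` elements `e_0, …, e_{n-1}`: a strict partial order
`rel` on the labels (`rel i j` means `e_i ≺ e_j`) that is naturally labelled, i.e. `e_i ≺ e_j`
implies `i < j` (so irreflexivity is automatic). These are the nodes at level `n` of the tree of
labelled causal sets. -/
@[ext]
structure Node (n : ℕ) where
  rel : Fin n → Fin n → Prop
  trans : ∀ i j k, rel i j → rel j k → rel i k
  lt_of_rel : ∀ i j, rel i j → i < j

instance (n : ℕ) : Finite (Node n) :=
  Finite.of_injective (fun c : Node n => c.rel) (fun _ _ h => Node.ext h)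

noncomputable instance (n : ℕ) : Fintype (Node n) := Fintype.ofFinite _

/-- The sample space `Ω` of completed growth processes: naturally labelled causal sets on the
labels `0, 1, 2, …`. The natural labelling makes every past finite. -/
@[ext]
structure History where
  rel : ℕ → ℕ → Prop
  trans : ∀ i j k, rel i j → rel j k → rel i k
  lt_of_rel : ∀ i j, rel i j → i < j

/-- The causal set formed by the first `n` elements of an infinite one. -/
def History.restrict (ω : History) (n : ℕ) : Node n where
  rel i j := ω.rel i j
  trans i j k := ω.trans i j k
  lt_of_rel i j h := ω.lt_of_rel i j h

/-- The parent of a node in the tree: drop the element that was born last. -/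
def Node.parent {n : ℕ} (c : Node (n + 1)) : Node n where
  rel i j := c.rel i.castSucc j.castSucc
  trans i j k := c.trans i.castSucc j.castSucc k.castSucc
  lt_of_rel i j h := by simpa using c.lt_of_rel i.castSucc j.castSucc h

open Classical in
/-- The precursor set of the transition from `c.parent` to `c`: the past of the new element. -/
noncomputable def Node.precursor {n : ℕ} (c : Node (n + 1)) : Finset (Fin n) :=
  {i : Fin n | c.rel i.castSucc (Fin.last n)}

open Classical in
/-- The maximal elements of the precursor set. -/
noncomputable def Node.maxPrecursor {n : ℕ} (c : Node (n + 1)) : Finset (Fin n) :=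
  {i ∈ c.precursor | ∀ j ∈ c.precursor, ¬ c.parent.rel i j}

/-- `λ(a,b) = ∑_{k=b}^{a} C(a-b, k-b) t_k`; it is only used for `b ≤ a`. -/
noncomputable def lam (t : ℕ → ℂ) (a b : ℕ) : ℂ :=
  ∑ k ∈ Finset.Icc b a, ((a - b).choose (k - b) : ℂ) * t k

/-- The amplitude `λ(ϖ,m) / λ(n,0)` of the transition `c.parent → c` out of the `n`-element node
`c.parent`, with `ϖ` the size of the precursor set and `m` the number of its maximal elements. -/
noncomputable def transitionAmplitude (t : ℕ → ℂ) {n : ℕ} (c : Node (n + 1)) : ℂ :=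
  lam t c.precursor.card c.maxPrecursor.card / lam t n 0

/-- The amplitude of a node: the product of the transition amplitudes along the branch that joins
the one-element node to it. -/
noncomputable def nodeAmplitude (t : ℕ → ℂ) : {n : ℕ} → Node n → ℂ
  | 0, _ => 1
  | 1, _ => 1
  | _ + 2, c => nodeAmplitude t c.parent * transitionAmplitude t c

/-- The cylinder set of a node. -/
def cyl {n : ℕ} (c : Node n) : Set History := {ω | ω.restrict n = c}

/-- The event algebra: the algebra of sets generated by the cylinder sets. -/
def eventAlgebra : Set (Set History) :=
  MeasureTheory.generateSetAlgebra {α | ∃ (n : ℕ) (c : Node n), α = cyl c}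

/-- `α` is a union of cylinder sets of `n`-element nodes. -/
def IsLevel (n : ℕ) (α : Set History) : Prop :=
  ∃ S : Set (Node n), α = ⋃ c ∈ S, cyl c

open Classical in
/-- The complex measure of the sequential growth dynamics with couplings `t`. The event `α` is
split into its fine partition, the cylinder sets of `n`-element nodes contained in `α` for the
smallest `n` such that `α` is a union of cylinder sets of level `n` (such an `n` exists for every
member of the event algebra; the value `0` on other sets is never used), and the amplitudes of
these nodes are added. -/
noncomputable def csgMeasure (t : ℕ → ℂ) (α : Set History) : ℂ :=
  if h : ∃ n, IsLevel n α then
    ∑ c : Node (Nat.find h) with cyl c ⊆ α, nodeAmplitude t c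
  else 0

/-- The variation on `α` of a complex set function `μ` on the algebra `𝔄`: the supremum of
`∑ ‖μ(α_i)‖` over the finite partitions of `α` into members of `𝔄`. -/
noncomputable def variation {X : Type*} (𝔄 : Set (Set X)) (μ : Set X → ℂ) (α : Set X) :
    ENNReal :=
  ⨆ (π : Finset (Set X)) (_ : (π : Set (Set X)) ⊆ 𝔄)
    (_ : (π : Set (Set X)).PairwiseDisjoint id) (_ : ⋃₀ (π : Set (Set X)) = α),
    ∑ β ∈ π, ‖μ β‖ₑ

/-- The dynamics with couplings `t` is of bounded variation: `|μ|(Ω) < ∞`. -/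
def HasBoundedVariation (t : ℕ → ℂ) : Prop :=
  variation eventAlgebra (csgMeasure t) Set.univ < ⊤

/-- `z ∈ ℝ⁺`. -/
def IsPosReal (z : ℂ) : Prop := ∃ r : ℝ, 0 < r ∧ z = r

end CSG

namespace CSG

/-! ### Children of a node -/

/-! Bounded variation reduces to finite levels: any finite partition into events is refined by the
cylinders of some level `n`. So `|μ|(Ω)` is the supremum over `n` of the sums `V_n` of the absolute
node amplitudes (`hasBoundedVariation_iff`).

The numerator `λ(ϖ,m')` is the sum of `t_|S|` over the sets `S` whose down-closure is the given
past. Each subset of a node generates exactly one child, so the numerators of its children add up to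
`λ(n,0)`, and the same count holds with `‖t_k‖` in place of `t_k` (`sum_children`). The latter total
depends only on `n`, whence `V_n ≤ ∏_{r<n} ρ_r` with `ρ_r = lamNorm t r 0 / ‖λ(r,0)‖ ≥ 1`, and
equality holds when no numerator suffers cancellation.

Boundedness thus follows from `∑ (ρ_r - 1) < ∞`. For positive couplings `ρ_r = 1`. If the top index
`K` exceeds the next one `J` by at least 2, then `λ(n,0)` has order `n^K` and `ρ_n - 1 =
O(n^(J-K))`, which is summable. If only `t_0` and `t_1` occur, each numerator is a single term, so
`V_n` equals the product; unless `t_1/t_0` is positive, `ρ_n - 1 ≥ c/n` with `c > 0`, and the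
product diverges with the harmonic series. -/

theorem Node.mem_precursor {n : ℕ} (c : Node (n + 1)) (i : Fin n) :
    i ∈ c.precursor ↔ c.rel i.castSucc (Fin.last n) := by
  simp [Node.precursor]

theorem Node.mem_maxPrecursor {n : ℕ} (c : Node (n + 1)) (i : Fin n) :
    i ∈ c.maxPrecursor ↔ i ∈ c.precursor ∧ ∀ j ∈ c.precursor, ¬ c.parent.rel i j := by
  simp [Node.maxPrecursor]

theorem Node.maxPrecursor_subset {n : ℕ} (c : Node (n + 1)) :
    c.maxPrecursor ⊆ c.precursor :=
  fun i hi => ((c.mem_maxPrecursor i).1 hi).1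

/-- Every element of the precursor set lies weakly below a maximal one. -/
theorem Node.exists_maxPrecursor {n : ℕ} (c : Node (n + 1)) :
    ∀ i ∈ c.precursor, ∃ s ∈ c.maxPrecursor, i = s ∨ c.parent.rel i s := by
  intro i
  -- Relations raise labels, so climbing from `i` inside the precursor must stop; `n - i` measures
  -- the remaining room.
  induction hd : n - (i : ℕ) using Nat.strong_induction_on generalizing i with
  | _ d ih =>
    intro hi
    by_cases h : ∀ j ∈ c.precursor, ¬ c.parent.rel i j
    · exact ⟨i, (c.mem_maxPrecursor i).2 ⟨hi, h⟩, Or.inl rfl⟩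
    · push Not at h
      obtain ⟨j, hj, hij⟩ := h
      have hlt : (i : ℕ) < j := c.parent.lt_of_rel i j hij
      have hjn := j.isLt
      obtain ⟨s, hs, hjs⟩ := ih (n - (j : ℕ)) (by omega) j rfl hj
      refine ⟨s, hs, Or.inr ?_⟩
      rcases hjs with rfl | hjs
      · exact hij
      · exact c.parent.trans _ _ _ hij hjs

theorem Node.maxPrecursor_card_pos {n : ℕ} (c : Node (n + 1)) (h : 0 < c.precursor.card) :
    0 < c.maxPrecursor.card := by
  obtain ⟨i, hi⟩ := Finset.card_pos.1 h
  obtain ⟨s, hs, -⟩ := c.exists_maxPrecursor i hi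
  exact Finset.card_pos.2 ⟨s, hs⟩

/-- A node is determined by its parent and the precursor set of its last element. -/
theorem Node.ext_parent {n : ℕ} {c d : Node (n + 1)} (hp : c.parent = d.parent)
    (hc : c.precursor = d.precursor) : c = d := by
  have hlast : ∀ (e : Node (n + 1)) (j : Fin (n + 1)), ¬ e.rel (Fin.last n) j := fun e j h =>
    absurd (e.lt_of_rel _ _ h) (not_lt.2 (Fin.le_last j))
  ext i j
  induction i using Fin.lastCases with
  | last => simp [hlast]
  | cast i =>
    induction j using Fin.lastCases with
    | last => rw [← Node.mem_precursor, ← Node.mem_precursor, hc]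
    | cast j => exact iff_of_eq (congrFun (congrFun (congrArg Node.rel hp) i) j)

/-- The child of `p` whose new element has as its past the down-closure of `S`. -/
def Node.child {n : ℕ} (p : Node n) (S : Finset (Fin n)) : Node (n + 1) where
  rel i j := (∃ a b, i = Fin.castSucc a ∧ j = Fin.castSucc b ∧ p.rel a b) ∨
    (∃ a, i = Fin.castSucc a ∧ j = Fin.last n ∧ ∃ s ∈ S, a = s ∨ p.rel a s)
  trans := by
    rintro i j k (⟨a, b, rfl, rfl, hab⟩ | ⟨a, rfl, rfl, -⟩)
      (⟨b', d, hb, rfl, hbd⟩ | ⟨b', hb, rfl, s, hs, hbs⟩)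
    · obtain rfl := Fin.castSucc_injective _ hb
      exact Or.inl ⟨a, d, rfl, rfl, p.trans _ _ _ hab hbd⟩
    · obtain rfl := Fin.castSucc_injective _ hb
      refine Or.inr ⟨a, rfl, rfl, s, hs, Or.inr ?_⟩
      rcases hbs with rfl | hbs
      · exact hab
      · exact p.trans _ _ _ hab hbs
    · exact absurd hb.symm (Fin.castSucc_lt_last b').ne
    · exact absurd hb.symm (Fin.castSucc_lt_last b').ne
  lt_of_rel := by
    rintro i j (⟨a, b, rfl, rfl, hab⟩ | ⟨a, rfl, rfl, -⟩)
    · exact Fin.castSucc_lt_castSucc_iff.2 (p.lt_of_rel _ _ hab)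
    · exact Fin.castSucc_lt_last a

theorem Node.child_parent {n : ℕ} (p : Node n) (S : Finset (Fin n)) :
    (p.child S).parent = p := by
  ext i j
  constructor
  · rintro (⟨a, b, ha, hb, hab⟩ | ⟨a, -, h, -⟩)
    · obtain rfl := Fin.castSucc_injective _ ha
      obtain rfl := Fin.castSucc_injective _ hb
      exact hab
    · exact absurd h (Fin.castSucc_lt_last j).ne
  · exact fun h => Or.inl ⟨i, j, rfl, rfl, h⟩

theorem Node.mem_child_precursor {n : ℕ} (p : Node n) (S : Finset (Fin n)) (i : Fin n) :
    i ∈ (p.child S).precursor ↔ ∃ s ∈ S, i = s ∨ p.rel i s := by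
  rw [Node.mem_precursor]
  constructor
  · rintro (⟨a, b, -, h, -⟩ | ⟨a, ha, -, h⟩)
    · exact absurd h.symm (Fin.castSucc_lt_last b).ne
    · obtain rfl := Fin.castSucc_injective _ ha
      exact h
  · exact fun h => Or.inr ⟨i, rfl, rfl, h⟩

/-- The sets that generate the precursor set of `c` are those between its maximal elements and the
whole of it. -/
theorem Node.child_eq_iff {n : ℕ} (p : Node n) (S : Finset (Fin n)) (c : Node (n + 1))
    (hc : c.parent = p) : p.child S = c ↔ S ∈ Finset.Icc c.maxPrecursor c.precursor := by
  rw [Finset.mem_Icc]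
  constructor
  · rintro rfl
    constructor
    · intro i hi
      obtain ⟨hi, hmax⟩ := (Node.mem_maxPrecursor _ i).1 hi
      obtain ⟨s, hs, rfl | his⟩ := (p.mem_child_precursor S i).1 hi
      · exact hs
      · refine absurd ?_ (hmax s ((p.mem_child_precursor S s).2 ⟨s, hs, Or.inl rfl⟩))
        rwa [hc]
    · exact fun i hi => (p.mem_child_precursor S i).2 ⟨i, hi, Or.inl rfl⟩
  · rintro ⟨h₁, h₂⟩
    refine Node.ext_parent ((p.child_parent S).trans hc.symm) ?_
    ext i
    rw [p.mem_child_precursor]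
    subst hc
    constructor
    · rintro ⟨s, hs, rfl | his⟩
      · exact h₂ hs
      · rw [Node.mem_precursor]
        exact c.trans _ _ _ his ((c.mem_precursor s).1 (h₂ hs))
    · intro hi
      obtain ⟨s, hs, h⟩ := c.exists_maxPrecursor i hi
      exact ⟨s, h₁ hs, h⟩

/-- Removing `A` identifies the interval with the subsets of `B \ A`, which are then counted by
size. -/
theorem sum_Icc_apply_card {α M : Type*} [DecidableEq α] [AddCommMonoid M] (f : ℕ → M)
    {A B : Finset α} (h : A ⊆ B) :
    ∑ S ∈ Finset.Icc A B, f S.card =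
      ∑ k ∈ Finset.Icc A.card B.card, (B.card - A.card).choose (k - A.card) • f k := by
  have hdisj : ∀ T ∈ (B \ A).powerset, Disjoint A T := fun T hT =>
    Finset.disjoint_sdiff.mono_right (Finset.mem_powerset.1 hT)
  rw [Finset.Icc_eq_image_powerset h, Finset.sum_image]
  · rw [Finset.sum_congr rfl (g := fun T => f (A.card + T.card))
      fun T hT => by rw [Finset.card_union_of_disjoint (hdisj T hT)]]
    rw [Finset.sum_powerset_apply_card (fun k => f (A.card + k)), Finset.card_sdiff_of_subset h]
    have hle := Finset.card_le_card h
    rw [← Finset.Ico_add_one_right_eq_Icc, Finset.sum_Ico_eq_sum_range,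
      show B.card + 1 - A.card = B.card - A.card + 1 by omega]
    simp
  · intro T hT U hU hTU
    have := congrArg (· \ A) hTU
    simpa [Finset.union_sdiff_cancel_left (hdisj T hT),
      Finset.union_sdiff_cancel_left (hdisj U hU)] using this

open Classical in
/-- The sum rule: summing over all children of a node the sums over the sets that generate their
precursors gives the sum over all sets of elements of the node. -/
theorem sum_children {M : Type*} [AddCommMonoid M] (f : ℕ → M) {n : ℕ} (p : Node n) :
    ∑ c : Node (n + 1) with c.parent = p,
      ∑ k ∈ Finset.Icc c.maxPrecursor.card c.precursor.card,
        (c.precursor.card - c.maxPrecursor.card).choose (k - c.maxPrecursor.card) • f k =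
      ∑ k ∈ Finset.range (n + 1), n.choose k • f k := by
  have h := Finset.sum_powerset_apply_card f (x := (Finset.univ : Finset (Fin n)))
  rw [Finset.card_fin] at h
  -- Partition the subsets of `p` according to the child they generate; the fibres are the intervals
  -- of `child_eq_iff`.
  rw [← h, ← Finset.sum_fiberwise_of_maps_to (s := (Finset.univ : Finset (Fin n)).powerset)
    (t := ({c : Node (n + 1) | c.parent = p} : Finset _)) (g := p.child)
    (fun S _ => by simp [p.child_parent])]
  refine Finset.sum_congr rfl fun c hc => ?_
  rw [← sum_Icc_apply_card f c.maxPrecursor_subset]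
  refine Finset.sum_congr ?_ fun _ _ => rfl
  ext S
  rw [← p.child_eq_iff S c (by simpa using hc)]
  simp

/-! ### Sums of amplitudes -/

/-- `λ(a,b)` for the couplings `‖t_k‖`. -/
noncomputable def lamNorm (t : ℕ → ℂ) (a b : ℕ) : ℝ :=
  ∑ k ∈ Finset.Icc b a, ((a - b).choose (k - b) : ℝ) * ‖t k‖

theorem norm_lam_le (t : ℕ → ℂ) (a b : ℕ) : ‖lam t a b‖ ≤ lamNorm t a b := by
  refine (norm_sum_le _ _).trans (le_of_eq ?_)
  simp [lamNorm]

theorem lam_zero_right (t : ℕ → ℂ) (n : ℕ) :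
    lam t n 0 = ∑ k ∈ Finset.range (n + 1), (n.choose k : ℂ) * t k := by
  simp [lam, Finset.range_eq_Ico, Finset.Ico_add_one_right_eq_Icc]

theorem lamNorm_zero_right (t : ℕ → ℂ) (n : ℕ) :
    lamNorm t n 0 = ∑ k ∈ Finset.range (n + 1), (n.choose k : ℝ) * ‖t k‖ := by
  simp [lamNorm, Finset.range_eq_Ico, Finset.Ico_add_one_right_eq_Icc]

open Classical in
theorem sum_lam_children (t : ℕ → ℂ) {n : ℕ} (p : Node n) :
    ∑ c : Node (n + 1) with c.parent = p, lam t c.precursor.card c.maxPrecursor.card =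
      lam t n 0 := by
  have h := sum_children t p
  simp only [nsmul_eq_mul] at h
  rw [lam_zero_right, ← h]
  rfl

open Classical in
theorem sum_lamNorm_children (t : ℕ → ℂ) {n : ℕ} (p : Node n) :
    ∑ c : Node (n + 1) with c.parent = p, lamNorm t c.precursor.card c.maxPrecursor.card =
      lamNorm t n 0 := by
  have h := sum_children (fun k => ‖t k‖) p
  simp only [nsmul_eq_mul] at h
  rw [lamNorm_zero_right, ← h]
  rfl

instance : Unique (Node 0) where
  default := ⟨fun i => i.elim0, fun i => i.elim0, fun i => i.elim0⟩
  uniq c := by ext i; exact i.elim0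

/-- The transition from the empty node, left out of the definition, has amplitude `t_0 / t_0 = 1`;
hence products may start at level 0. -/
theorem nodeAmplitude_succ {t : ℕ → ℂ} (ht : t 0 ≠ 0) {n : ℕ} (c : Node (n + 1)) :
    nodeAmplitude t c = nodeAmplitude t c.parent * transitionAmplitude t c := by
  cases n with
  | zero =>
    have h₁ : c.precursor = ∅ := Subsingleton.elim _ _
    have h₂ : c.maxPrecursor = ∅ := Subsingleton.elim _ _
    simp [nodeAmplitude, transitionAmplitude, h₁, h₂, lam, ht]
  | succ n => rfl

/-- The sum of the absolute amplitudes of the `n`-element nodes. -/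
noncomputable def levelVariation (t : ℕ → ℂ) (n : ℕ) : ℝ := ∑ c : Node n, ‖nodeAmplitude t c‖

theorem levelVariation_zero (t : ℕ → ℂ) : levelVariation t 0 = 1 := by
  simp [levelVariation, nodeAmplitude]

open Classical in
theorem levelVariation_succ {t : ℕ → ℂ} (ht : t 0 ≠ 0) (n : ℕ) :
    levelVariation t (n + 1) = ∑ p : Node n, ‖nodeAmplitude t p‖ *
      ((∑ c : Node (n + 1) with c.parent = p, ‖lam t c.precursor.card c.maxPrecursor.card‖) /
        ‖lam t n 0‖) := by
  rw [levelVariation, ← Finset.sum_fiberwise (s := Finset.univ) (g := Node.parent)]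
  refine Finset.sum_congr rfl fun p _ => ?_
  rw [Finset.sum_div, Finset.mul_sum]
  refine Finset.sum_congr rfl fun c hc => ?_
  rw [nodeAmplitude_succ ht, (Finset.mem_filter.1 hc).2, norm_mul, transitionAmplitude, norm_div]

/-- The bound on the sum over the children is the same for all parents of a level, so it factors
out. -/
theorem levelVariation_le_prod {t : ℕ → ℂ} (ht : t 0 ≠ 0) (n : ℕ) :
    levelVariation t n ≤ ∏ r ∈ Finset.range n, (lamNorm t r 0 / ‖lam t r 0‖) := by
  induction n with
  | zero => simp [levelVariation_zero]
  | succ n ih =>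
    rw [Finset.prod_range_succ, levelVariation_succ ht]
    refine le_trans ?_ (mul_le_mul_of_nonneg_right ih
      (div_nonneg ((norm_nonneg _).trans (norm_lam_le t n 0)) (norm_nonneg _)))
    rw [levelVariation, Finset.sum_mul]
    gcongr with p
    rw [← sum_lamNorm_children t p]
    gcongr
    exact norm_lam_le _ _ _

theorem levelVariation_eq_prod {t : ℕ → ℂ} (ht : t 0 ≠ 0)
    (h : ∀ n (c : Node (n + 1)), ‖lam t c.precursor.card c.maxPrecursor.card‖ =
      lamNorm t c.precursor.card c.maxPrecursor.card) (n : ℕ) :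
    levelVariation t n = ∏ r ∈ Finset.range n, (lamNorm t r 0 / ‖lam t r 0‖) := by
  induction n with
  | zero => simp [levelVariation_zero]
  | succ n ih =>
    rw [Finset.prod_range_succ, levelVariation_succ ht, ← ih, levelVariation, Finset.sum_mul]
    refine Finset.sum_congr rfl fun p _ => ?_
    simp only [h, sum_lamNorm_children]

/-! ### The measure on the event algebra -/

/-- In this form, closure under complements, unions and passing to a higher level is immediate. -/
theorem isLevel_iff {n : ℕ} {α : Set History} :
    IsLevel n α ↔ ∀ ω ω' : History, ω.restrict n = ω'.restrict n → ω ∈ α → ω' ∈ α := by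
  constructor
  · rintro ⟨S, rfl⟩ ω ω' h hω
    simp only [Set.mem_iUnion, cyl, Set.mem_ofPred_eq] at hω ⊢
    rwa [← h]
  · intro h
    refine ⟨{c | cyl c ⊆ α}, Set.Subset.antisymm (fun ω hω => ?_) ?_⟩
    · exact Set.mem_biUnion (x := ω.restrict n) (fun ω' h' => h ω ω' (Eq.symm h') hω) rfl
    · exact Set.iUnion₂_subset fun c hc => hc

theorem History.restrict_succ_parent (ω : History) (n : ℕ) :
    (ω.restrict (n + 1)).parent = ω.restrict n := rfl

theorem IsLevel.succ {n : ℕ} {α : Set History} (h : IsLevel n α) : IsLevel (n + 1) α := by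
  rw [isLevel_iff] at h ⊢
  intro ω ω' hω
  refine h ω ω' ?_
  rw [← History.restrict_succ_parent, hω, History.restrict_succ_parent]

theorem IsLevel.mono {n N : ℕ} {α : Set History} (h : IsLevel n α) (hN : n ≤ N) :
    IsLevel N α := by
  induction hN with
  | refl => exact h
  | step _ ih => exact ih.succ

theorem isLevel_cyl {n : ℕ} (c : Node n) : IsLevel n (cyl c) :=
  isLevel_iff.2 fun _ _ h h' => h.symm.trans h'

theorem exists_isLevel {α : Set History} (h : α ∈ eventAlgebra) : ∃ n, IsLevel n α := by
  induction h with
  | base s hs =>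
    obtain ⟨n, c, rfl⟩ := hs
    exact ⟨n, isLevel_cyl c⟩
  | empty => exact ⟨0, isLevel_iff.2 fun _ _ _ h => h⟩
  | compl s _ ih =>
    obtain ⟨n, hn⟩ := ih
    exact ⟨n, isLevel_iff.2 fun ω ω' h hω hω' => hω (isLevel_iff.1 hn ω' ω h.symm hω')⟩
  | union s t _ _ ihs iht =>
    obtain ⟨n, hn⟩ := ihs
    obtain ⟨k, hk⟩ := iht
    have hn := isLevel_iff.1 (hn.mono (le_max_left n k))
    have hk := isLevel_iff.1 (hk.mono (le_max_right n k))
    exact ⟨max n k, isLevel_iff.2 fun ω ω' h => Or.imp (hn ω ω' h) (hk ω ω' h)⟩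

theorem cyl_nonempty {n : ℕ} (c : Node n) : (cyl c).Nonempty := by
  -- Extend `c` by elements unrelated to everything.
  refine ⟨⟨fun i j => ∃ (hi : i < n) (hj : j < n), c.rel ⟨i, hi⟩ ⟨j, hj⟩, ?_, ?_⟩, ?_⟩
  · rintro i j k ⟨hi, hj, h⟩ ⟨_, hk, h'⟩
    exact ⟨hi, hk, c.trans _ _ _ h h'⟩
  · rintro i j ⟨hi, hj, h⟩
    exact c.lt_of_rel _ _ h
  · ext i j
    simp [History.restrict]

theorem IsLevel.cyl_subset_iff {n : ℕ} {α : Set History} (h : IsLevel n α) {c : Node n}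
    {ω : History} (hω : ω ∈ cyl c) : cyl c ⊆ α ↔ ω ∈ α :=
  ⟨fun hc => hc hω, fun hα _ hω' => isLevel_iff.1 h _ _ (hω.trans (Eq.symm hω')) hα⟩

theorem cyl_subset_cyl_parent {n : ℕ} (c : Node (n + 1)) : cyl c ⊆ cyl c.parent := by
  rintro ω rfl
  rfl

open Classical in
theorem IsLevel.sum_nodeAmplitude_succ {t : ℕ → ℂ} (hlam : ∀ n, lam t n 0 ≠ 0) {n : ℕ}
    {α : Set History} (h : IsLevel n α) :
    ∑ c : Node (n + 1) with cyl c ⊆ α, nodeAmplitude t c =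
      ∑ c : Node n with cyl c ⊆ α, nodeAmplitude t c := by
  have ht : t 0 ≠ 0 := by simpa [lam] using hlam 0
  have hsub : ∀ c : Node (n + 1), cyl c ⊆ α ↔ cyl c.parent ⊆ α := fun c => by
    obtain ⟨ω, hω⟩ := cyl_nonempty c
    rw [h.succ.cyl_subset_iff hω, h.cyl_subset_iff (cyl_subset_cyl_parent c hω)]
  rw [← Finset.sum_fiberwise_of_maps_to (g := Node.parent)
    (t := ({c : Node n | cyl c ⊆ α} : Finset _)) (fun c hc => by simpa [hsub] using hc)]
  refine Finset.sum_congr rfl fun p hp => ?_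
  have hset : ({c ∈ ({c : Node (n + 1) | cyl c ⊆ α} : Finset _) | c.parent = p} : Finset _) =
      ({c : Node (n + 1) | c.parent = p} : Finset _) := by
    ext c
    simp only [Finset.mem_filter, Finset.mem_univ, true_and, hsub]
    constructor
    · exact fun h => h.2
    · rintro rfl
      exact ⟨by simpa using hp, rfl⟩
  rw [hset, Finset.sum_congr rfl (g := fun c => nodeAmplitude t p *
    (lam t c.precursor.card c.maxPrecursor.card / lam t n 0)), ← Finset.mul_sum,
    ← Finset.sum_div, sum_lam_children, div_self (hlam n), mul_one]
  intro c hc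
  rw [nodeAmplitude_succ ht, (Finset.mem_filter.1 hc).2, transitionAmplitude]

open Classical in
/-- The measure of an event may be computed at any level at which it is a union of cylinders. -/
theorem IsLevel.csgMeasure_eq {t : ℕ → ℂ} (hlam : ∀ n, lam t n 0 ≠ 0) {n : ℕ}
    {α : Set History} (h : IsLevel n α) :
    csgMeasure t α = ∑ c : Node n with cyl c ⊆ α, nodeAmplitude t c := by
  have hex : ∃ n, IsLevel n α := ⟨n, h⟩
  rw [csgMeasure, dif_pos hex]
  -- Minimality of the level serves only to give `k ≤ n`; the sum is then carried from `k` up to `n`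
  -- one level at a time.
  have hle := Nat.find_min' hex h
  have hspec := Nat.find_spec hex
  generalize Nat.find hex = k at hle hspec
  induction hle with
  | refl => rfl
  | step hle ih =>
    have hk := hspec.mono hle
    rw [hk.sum_nodeAmplitude_succ hlam, ← ih hk]

theorem cyl_injective {n : ℕ} : Function.Injective (cyl : Node n → Set History) := by
  intro c d h
  obtain ⟨ω, hω⟩ := cyl_nonempty c
  have hω' : ω ∈ cyl d := h ▸ hω
  exact Eq.trans (Eq.symm hω) hω'

theorem csgMeasure_cyl {t : ℕ → ℂ} (hlam : ∀ n, lam t n 0 ≠ 0) {n : ℕ} (c : Node n) :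
    csgMeasure t (cyl c) = nodeAmplitude t c := by
  classical
  rw [(isLevel_cyl c).csgMeasure_eq hlam, Finset.sum_eq_single c]
  · intro d hd hne
    obtain ⟨ω, hω⟩ := cyl_nonempty d
    have hω' : ω ∈ cyl c := (Finset.mem_filter.1 hd).2 hω
    exact absurd (Eq.trans (Eq.symm hω) hω') hne
  · simp

theorem ofReal_levelVariation (t : ℕ → ℂ) (n : ℕ) :
    ENNReal.ofReal (levelVariation t n) = ∑ c : Node n, ‖nodeAmplitude t c‖ₑ := by
  rw [levelVariation, ENNReal.ofReal_sum_of_nonneg fun _ _ => norm_nonneg _]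
  simp

theorem levelVariation_le_variation {t : ℕ → ℂ} (hlam : ∀ n, lam t n 0 ≠ 0) (n : ℕ) :
    ENNReal.ofReal (levelVariation t n) ≤
      variation eventAlgebra (csgMeasure t) Set.univ := by
  classical
  let π : Finset (Set History) := Finset.univ.image (cyl : Node n → Set History)
  have h₁ : (π : Set (Set History)) ⊆ eventAlgebra := by
    intro α hα
    obtain ⟨c, -, rfl⟩ := Finset.mem_image.1 (Finset.mem_coe.1 hα)
    exact MeasureTheory.self_subset_generateSetAlgebra ⟨n, c, rfl⟩
  have h₂ : (π : Set (Set History)).PairwiseDisjoint id := by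
    intro α hα β hβ hne
    obtain ⟨c, -, rfl⟩ := Finset.mem_image.1 (Finset.mem_coe.1 hα)
    obtain ⟨d, -, rfl⟩ := Finset.mem_image.1 (Finset.mem_coe.1 hβ)
    refine Set.disjoint_left.2 fun ω hω hω' => hne ?_
    rw [Eq.trans (Eq.symm hω) hω']
  have h₃ : ⋃₀ (π : Set (Set History)) = Set.univ :=
    Set.eq_univ_of_forall fun ω => ⟨cyl (ω.restrict n), by simp [π], rfl⟩
  refine le_trans (le_of_eq ?_) (le_iSup₂_of_le π h₁ (le_iSup₂_of_le h₂ h₃ le_rfl))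
  rw [ofReal_levelVariation, Finset.sum_image fun _ _ _ _ h => cyl_injective h]
  simp only [csgMeasure_cyl hlam]

theorem variation_le_iSup_levelVariation {t : ℕ → ℂ} (hlam : ∀ n, lam t n 0 ≠ 0) :
    variation eventAlgebra (csgMeasure t) Set.univ ≤
      ⨆ n, ENNReal.ofReal (levelVariation t n) := by
  classical
  refine iSup₂_le fun π h₁ => iSup₂_le fun h₂ _ => ?_
  have hlevel : ∃ N, ∀ β ∈ π, IsLevel N β := by
    choose! f hf using fun β (hβ : β ∈ π) => exists_isLevel (h₁ hβ)
    exact ⟨π.sup f, fun β hβ => (hf β hβ).mono (Finset.le_sup hβ)⟩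
  obtain ⟨N, hN⟩ := hlevel
  refine le_trans ?_ (le_iSup _ N)
  calc ∑ β ∈ π, ‖csgMeasure t β‖ₑ
      ≤ ∑ β ∈ π, ∑ c : Node N with cyl c ⊆ β, ‖nodeAmplitude t c‖ₑ := by
        refine Finset.sum_le_sum fun β hβ => ?_
        rw [(hN β hβ).csgMeasure_eq hlam]
        exact enorm_sum_le _ _
    _ = ∑ c ∈ π.biUnion fun β => ({c : Node N | cyl c ⊆ β} : Finset _),
          ‖nodeAmplitude t c‖ₑ := by
        -- Cylinders are nonempty, so no node can lie inside two disjoint events.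
        refine (Finset.sum_biUnion fun β hβ γ hγ hne => ?_).symm
        refine Finset.disjoint_left.2 fun c hc hc' => ?_
        obtain ⟨ω, hω⟩ := cyl_nonempty c
        exact Set.disjoint_left.1 (h₂ hβ hγ hne) ((Finset.mem_filter.1 hc).2 hω)
          ((Finset.mem_filter.1 hc').2 hω)
    _ ≤ ∑ c : Node N, ‖nodeAmplitude t c‖ₑ :=
        Finset.sum_le_sum_of_subset (Finset.subset_univ _)
    _ = ENNReal.ofReal (levelVariation t N) := (ofReal_levelVariation t N).symm

theorem hasBoundedVariation_iff {t : ℕ → ℂ} (hlam : ∀ n, lam t n 0 ≠ 0) :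
    HasBoundedVariation t ↔ ∃ C : ℝ, ∀ n, levelVariation t n ≤ C := by
  constructor
  · intro h
    refine ⟨(variation eventAlgebra (csgMeasure t) Set.univ).toReal, fun n => ?_⟩
    rw [← ENNReal.ofReal_le_iff_le_toReal h.ne]
    exact levelVariation_le_variation hlam n
  · rintro ⟨C, hC⟩
    refine (variation_le_iSup_levelVariation hlam).trans_lt ?_
    exact (iSup_le fun n => ENNReal.ofReal_le_ofReal (hC n)).trans_lt ENNReal.ofReal_lt_top

/-! ### Products of one-step variations -/

/-- Since binomials vanish for `k > n`, the index set can be made independent of `n`, ready for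
asymptotics. -/
theorem sum_range_choose_mul_eq {R : Type*} [Semiring R] (f : ℕ → R) (s : Finset ℕ)
    (hs : ∀ k ∉ s, f k = 0) (n : ℕ) :
    ∑ k ∈ Finset.range (n + 1), (n.choose k : R) * f k = ∑ k ∈ s, (n.choose k : R) * f k := by
  rw [Finset.sum_subset (Finset.subset_union_left (s₂ := s)),
    Finset.sum_subset (Finset.subset_union_right (s₁ := Finset.range (n + 1)) (s₂ := s))]
  · intro k _ hk
    rw [hs k hk, mul_zero]
  · intro k _ hk
    rw [Finset.mem_range, not_lt] at hk
    rw [Nat.choose_eq_zero_of_lt (by omega), Nat.cast_zero, zero_mul]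

/-- Apply `1 + x ≤ exp x` to each factor of the product bound. -/
theorem hasBoundedVariation_of_summable {t : ℕ → ℂ} (hlam : ∀ n, lam t n 0 ≠ 0)
    (h : Summable fun n => lamNorm t n 0 / ‖lam t n 0‖ - 1) : HasBoundedVariation t := by
  have ht : t 0 ≠ 0 := by simpa [lam] using hlam 0
  have hnonneg : ∀ n, 0 ≤ lamNorm t n 0 / ‖lam t n 0‖ - 1 := fun n => by
    rw [sub_nonneg, one_le_div (norm_pos_iff.2 (hlam n))]
    exact norm_lam_le t n 0
  rw [hasBoundedVariation_iff hlam]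
  refine ⟨Real.exp (∑' n, (lamNorm t n 0 / ‖lam t n 0‖ - 1)), fun n => ?_⟩
  refine (levelVariation_le_prod ht n).trans ?_
  have h' := Real.prod_one_add_le_exp_sum (Finset.range n) hnonneg
  simp only [add_sub_cancel] at h'
  exact h'.trans (Real.exp_le_exp.2 (h.sum_le_tsum _ fun n _ => hnonneg n))

theorem hasBoundedVariation_of_pos {t : ℕ → ℂ} (hlam : ∀ n, lam t n 0 ≠ 0)
    (h : ∀ k, t k = ‖t k‖) : HasBoundedVariation t := by
  refine hasBoundedVariation_of_summable hlam ?_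
  have heq : ∀ n, lamNorm t n 0 / ‖lam t n 0‖ - 1 = 0 := fun n => by
    have h₀ : 0 ≤ lamNorm t n 0 := (norm_nonneg _).trans (norm_lam_le t n 0)
    have h₁ : lam t n 0 = lamNorm t n 0 := by
      rw [lam, lamNorm, Complex.ofReal_sum]
      refine Finset.sum_congr rfl fun k _ => ?_
      rw [h k]
      simp
    have h₂ : ‖lam t n 0‖ = lamNorm t n 0 := by
      rw [h₁, Complex.norm_real, Real.norm_of_nonneg h₀]
    rw [← h₂, div_self (norm_ne_zero_iff.2 (hlam n)), sub_self]
  simpa only [heq] using summable_zero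

open Asymptotics Filter in
/-- If the largest index of a nonzero coupling exceeds all the others by at least two, then the
dynamics is of bounded variation. -/
theorem hasBoundedVariation_of_gap {t : ℕ → ℂ} (hlam : ∀ n, lam t n 0 ≠ 0) {J K : ℕ}
    (hJK : J + 2 ≤ K) (hK : t K ≠ 0) (hzero : ∀ k, J < k → k ≠ K → t k = 0) :
    HasBoundedVariation t := by
  set s := Finset.range (J + 1) with hs
  have hKs : K ∉ s := by simp [hs]; omega
  have hsupp : ∀ k ∉ insert K s, t k = 0 := fun k hk => by
    simp only [hs, Finset.mem_insert, Finset.mem_range, not_or, not_lt] at hk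
    exact hzero k (by omega) hk.1
  set rest : ℕ → ℝ := fun n => ∑ k ∈ s, (n.choose k : ℝ) * ‖t k‖ with hrest
  have hrest_le : ∀ n, ‖∑ k ∈ s, (n.choose k : ℂ) * t k‖ ≤ rest n := fun n =>
    (norm_sum_le _ _).trans (le_of_eq (by simp [hrest]))
  have hl : ∀ n, lam t n 0 = (n.choose K : ℂ) * t K + ∑ k ∈ s, (n.choose k : ℂ) * t k :=
    fun n => by rw [lam_zero_right, sum_range_choose_mul_eq t _ hsupp, Finset.sum_insert hKs]
  have hL : ∀ n, lamNorm t n 0 = (n.choose K : ℝ) * ‖t K‖ + rest n := fun n => by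
    rw [lamNorm_zero_right, sum_range_choose_mul_eq (fun k => ‖t k‖) _
      (fun k hk => by simp [hsupp k hk]), Finset.sum_insert hKs]
  have hrestO : rest =O[atTop] fun n : ℕ => (n : ℝ) ^ J := by
    refine IsBigO.fun_sum fun k hk => ?_
    have hk' : k ≤ J := by simpa [hs, Nat.lt_succ_iff] using hk
    refine IsBigO.of_bound ‖t k‖ ?_
    filter_upwards [eventually_ge_atTop 1] with n hn
    have h₁ : (n.choose k : ℝ) ≤ (n : ℝ) ^ J := by
      exact_mod_cast (Nat.choose_le_pow n k).trans (Nat.pow_le_pow_right hn hk')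
    rw [norm_mul, norm_norm, Real.norm_natCast, Real.norm_of_nonneg (by positivity), mul_comm]
    gcongr
  have hlit : (fun n : ℕ => (n : ℝ) ^ J) =o[atTop] fun n : ℕ => (n : ℝ) ^ K :=
    (isLittleO_pow_pow_atTop_of_lt (by omega)).comp_tendsto tendsto_natCast_atTop_atTop
  have hsum : (fun n => ∑ k ∈ s, (n.choose k : ℂ) * t k) =o[atTop] fun n : ℕ => (n : ℝ) ^ K := by
    refine IsBigO.trans_isLittleO (g := rest) (IsBigO.of_bound 1 ?_)
      (hrestO.trans_isLittleO hlit)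
    filter_upwards with n
    rw [one_mul]
    exact (hrest_le n).trans (le_abs_self _)
  have hmain : (fun n : ℕ => (n.choose K : ℂ) * t K) =Θ[atTop] fun n : ℕ => (n : ℝ) ^ K := by
    have h₁ : (fun n : ℕ => (n.choose K : ℂ)) =Θ[atTop] fun n : ℕ => (n.choose K : ℝ) :=
      IsTheta.of_norm_eventuallyEq (by simp)
    have h₂ := h₁.trans (isTheta_choose K)
    simpa only [mul_comm] using h₂.const_mul_left hK
  have hΘ : (fun n => ‖lam t n 0‖) =Θ[atTop] fun n : ℕ => (n : ℝ) ^ K := by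
    simp only [hl]
    exact (hmain.add_isLittleO hsum).norm_left
  refine hasBoundedVariation_of_summable hlam
    (summable_of_isBigO_nat (Real.summable_nat_pow_inv.2 one_lt_two) ?_)
  have hbound : (fun n => lamNorm t n 0 / ‖lam t n 0‖ - 1) =O[atTop]
      fun n => rest n / ‖lam t n 0‖ := by
    -- The rest counts twice: once in `lamNorm`, once in bounding the top term by `‖λ‖ + rest`.
    refine IsBigO.of_bound 2 (Eventually.of_forall fun n => ?_)
    have hpos : 0 < ‖lam t n 0‖ := norm_pos_iff.2 (hlam n)
    have hrest0 : 0 ≤ rest n := (norm_nonneg _).trans (hrest_le n)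
    have hge : (n.choose K : ℝ) * ‖t K‖ ≤ ‖lam t n 0‖ + rest n := by
      have h₁ : (n.choose K : ℂ) * t K = lam t n 0 - ∑ k ∈ s, (n.choose k : ℂ) * t k := by
        rw [hl, add_sub_cancel_right]
      calc (n.choose K : ℝ) * ‖t K‖ = ‖(n.choose K : ℂ) * t K‖ := by simp
        _ ≤ _ := by
          rw [h₁]
          exact (norm_sub_le _ _).trans (add_le_add_right (hrest_le n) _)
    rw [div_sub_one hpos.ne', norm_div, norm_div, norm_norm, ← mul_div_assoc,
      Real.norm_of_nonneg hrest0, Real.norm_of_nonneg (sub_nonneg.2 (norm_lam_le t n 0))]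
    gcongr
    rw [hL]
    linarith
  have hquot : (fun n => rest n / ‖lam t n 0‖) =O[atTop]
      fun n : ℕ => (n : ℝ) ^ J * ((n : ℝ) ^ K)⁻¹ := by
    simp only [div_eq_mul_inv]
    exact hrestO.mul hΘ.inv.isBigO
  refine (hbound.trans hquot).trans (IsBigO.of_bound 1 ?_)
  filter_upwards [eventually_ge_atTop 1] with n hn
  have hn' : (1 : ℝ) ≤ n := by exact_mod_cast hn
  rw [Real.norm_of_nonneg (by positivity), Real.norm_of_nonneg (by positivity), one_mul,
    ← div_eq_mul_inv, div_le_iff₀ (by positivity), ← div_eq_inv_mul, le_div_iff₀ (by positivity),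
    ← pow_add]
  exact pow_le_pow_right₀ hn' hJK

/-- If only `t_0` and `t_1` can be nonzero, then the numerator of every transition amplitude has a
single term. -/
theorem norm_lam_eq_lamNorm {t : ℕ → ℂ} (h : ∀ k, 1 < k → t k = 0) {n : ℕ} (c : Node (n + 1)) :
    ‖lam t c.precursor.card c.maxPrecursor.card‖ =
      lamNorm t c.precursor.card c.maxPrecursor.card := by
  -- Either `a = b = 0`, or `b ≥ 1` and every `k > b` has `t_k = 0`; so only `k = b` contributes.
  have hpos := c.maxPrecursor_card_pos
  have hle := Finset.card_le_card c.maxPrecursor_subset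
  generalize c.precursor.card = a at hpos hle
  generalize c.maxPrecursor.card = b at hpos hle
  rw [lam, lamNorm, Finset.sum_eq_single_of_mem b (Finset.mem_Icc.2 ⟨le_rfl, hle⟩),
    Finset.sum_eq_single_of_mem b (Finset.mem_Icc.2 ⟨le_rfl, hle⟩)]
  · simp
  all_goals
    intro k hk hne
    rw [Finset.mem_Icc] at hk
    rw [h k (by omega)]
    simp

theorem isPosReal_of_re_eq_norm {z : ℂ} (hz : z ≠ 0) (h : z.re = ‖z‖) : IsPosReal z :=
  ⟨‖z‖, norm_pos_iff.2 hz, (Complex.eq_coe_norm_of_nonneg (Complex.re_eq_norm.1 h))⟩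

/-- The excess of `1 + n‖z‖` over `‖1 + nz‖` decays no faster than harmonically unless `z` is a
nonnegative real. -/
theorem norm_sub_re_div_le {z : ℂ} {n : ℕ} (hn : 1 ≤ n) (hz : 1 + n * z ≠ 0) :
    (‖z‖ - z.re) / (1 + ‖z‖) ^ 2 * (1 / n) ≤ (1 + n * ‖z‖) / ‖1 + n * z‖ - 1 := by
  have hn' : (1 : ℝ) ≤ n := by exact_mod_cast hn
  have hN : 0 < ‖1 + n * z‖ := norm_pos_iff.2 hz
  have hδ : 0 ≤ ‖z‖ - z.re := sub_nonneg.2 (Complex.re_le_norm z)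
  have hb := norm_nonneg z
  have hle : ‖1 + n * z‖ ≤ 1 + n * ‖z‖ := (norm_add_le _ _).trans (by simp)
  have hsq : ‖1 + n * z‖ ^ 2 = 1 + 2 * n * z.re + n ^ 2 * ‖z‖ ^ 2 := by
    rw [Complex.sq_norm, Complex.sq_norm, Complex.normSq_apply, Complex.normSq_apply]
    simp
    ring
  set N := ‖1 + n * z‖
  set b := ‖z‖
  have hn0 : (0 : ℝ) < n := by linarith
  have hM : 1 + n * b ≤ n * (1 + b) := by nlinarith
  -- Difference of squares; the second factor is at most `2(1 + nb) ≤ 2n(1 + b)`, the source of one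
  -- factor `1 + b`. The other comes from `N ≤ n(1 + b)`.
  have hkey : 2 * n * (b - z.re) = (1 + n * b - N) * (1 + n * b + N) := by linear_combination hsq
  rw [div_sub_one hN.ne', ← mul_div_assoc, mul_one, div_div, div_le_div_iff₀ (by positivity) hN]
  have h₁ : 2 * n * (b - z.re) ≤ (1 + n * b - N) * (2 * (n * (1 + b))) := by
    rw [hkey]
    exact mul_le_mul_of_nonneg_left (by linarith) (by linarith)
  have h₂ : b - z.re ≤ (1 + n * b - N) * (1 + b) := by nlinarith
  calc (b - z.re) * N ≤ (1 + n * b - N) * (1 + b) * (n * (1 + b)) :=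
        mul_le_mul h₂ (by linarith) hN.le (mul_nonneg (by linarith) (by linarith))
    _ = _ := by ring

theorem one_add_sum_le_prod_one_add {ι : Type*} (s : Finset ι) {f : ι → ℝ} (hf : ∀ i, 0 ≤ f i) :
    1 + ∑ i ∈ s, f i ≤ ∏ i ∈ s, (1 + f i) := by
  classical
  induction s using Finset.induction_on with
  | empty => simp
  | insert a s ha ih =>
    rw [Finset.sum_insert ha, Finset.prod_insert ha]
    have := Finset.sum_nonneg fun i (_ : i ∈ s) => hf i
    nlinarith [hf a, mul_le_mul_of_nonneg_left ih (add_nonneg zero_le_one (hf a)),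
      mul_nonneg (hf a) this]

theorem not_hasBoundedVariation_of_linear {t : ℕ → ℂ} (hlam : ∀ n, lam t n 0 ≠ 0)
    (h : ∀ k, 1 < k → t k = 0) (h₁ : t 1 ≠ 0) (hpos : ¬ IsPosReal (t 1 / t 0)) :
    ¬ HasBoundedVariation t := by
  have ht : t 0 ≠ 0 := by simpa [lam] using hlam 0
  set z := t 1 / t 0 with hz
  have ht₁ : t 1 = t 0 * z := by rw [hz, mul_div_cancel₀ _ ht]
  have hδ : 0 < ‖z‖ - z.re := sub_pos.2 (lt_of_le_of_ne (Complex.re_le_norm z)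
    fun h => hpos (isPosReal_of_re_eq_norm (div_ne_zero h₁ ht) h))
  have hsupp : ∀ k ∉ ({0, 1} : Finset ℕ), t k = 0 := fun k hk => by
    simp only [Finset.mem_insert, Finset.mem_singleton, not_or] at hk
    exact h k (by omega)
  have hl : ∀ n, lam t n 0 = t 0 * (1 + n * z) := fun n => by
    rw [lam_zero_right, sum_range_choose_mul_eq t _ hsupp, Finset.sum_pair zero_ne_one, ht₁]
    simp
    ring
  have hL : ∀ n, lamNorm t n 0 = ‖t 0‖ * (1 + n * ‖z‖) := fun n => by
    rw [lamNorm_zero_right, sum_range_choose_mul_eq (fun k => ‖t k‖) _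
      (fun k hk => by simp [hsupp k hk]), Finset.sum_pair zero_ne_one, ht₁]
    simp
    ring
  rw [hasBoundedVariation_iff hlam]
  rintro ⟨C, hC⟩
  set a : ℕ → ℝ := fun n => lamNorm t n 0 / ‖lam t n 0‖ - 1 with ha
  have ha0 : ∀ n, 0 ≤ a n := fun n => by
    rw [ha, sub_nonneg, one_le_div (norm_pos_iff.2 (hlam n))]
    exact norm_lam_le t n 0
  -- `1 + ∑ a ≤ ∏ (1 + a) = V_n ≤ C` bounds the partial sums.
  have hsummable : Summable a := by
    refine summable_of_sum_range_le (c := C) ha0 fun n => ?_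
    have h₂ := one_add_sum_le_prod_one_add (Finset.range n) ha0
    have h₃ := hC n
    rw [levelVariation_eq_prod ht (fun _ c => norm_lam_eq_lamNorm h c)] at h₃
    simp only [ha, add_sub_cancel] at h₂ ⊢
    linarith
  have hc : (‖z‖ - z.re) / (1 + ‖z‖) ^ 2 ≠ 0 := by positivity
  refine Real.not_summable_one_div_natCast ((summable_mul_left_iff hc).1
    (Summable.of_nonneg_of_le (fun n => by positivity) (fun n => ?_) hsummable))
  rcases Nat.eq_zero_or_pos n with rfl | hn
  -- Here `1 / 0 = 0`, so nonnegativity of `a 0` suffices.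
  · simpa using ha0 0
  · have hne := hlam n
    rw [hl] at hne
    refine (norm_sub_re_div_le hn (right_ne_zero_of_mul hne)).trans (le_of_eq ?_)
    simp only [ha]
    rw [hl, hL, norm_mul, mul_div_mul_left _ _ (norm_ne_zero_iff.2 ht)]

theorem IsPosReal.eq_norm {z : ℂ} (h : IsPosReal z) : z = ‖z‖ := by
  obtain ⟨r, hr, rfl⟩ := h
  rw [Complex.norm_real, Real.norm_of_nonneg hr.le]

end CSG

/-- Couplings `t` whose nonzero members are exactly `t_0, t_{k 1}, …, t_{k m}` with
`0 = k 0 < k 1 < ⋯ < k m`, and for which all transition amplitudes are defined. -/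
theorem claim3 (t : ℕ → ℂ) (m : ℕ) (k : ℕ → ℕ)
    (hk0 : k 0 = 0) (hk : StrictMonoOn k (Set.Iic m))
    (ht : ∀ j, t j ≠ 0 ↔ ∃ i ≤ m, j = k i)
    (hlam : ∀ n, CSG.lam t n 0 ≠ 0) :
    ((∀ i ≤ m, CSG.IsPosReal (t (k i))) → CSG.HasBoundedVariation t) ∧
    (m = 1 → 1 < k 1 → CSG.HasBoundedVariation t) ∧
    (1 < m → k (m - 1) + 1 < k m → CSG.HasBoundedVariation t) ∧
    (m = 1 → k 1 = 1 → ¬ CSG.IsPosReal (t 1 / t 0) → ¬ CSG.HasBoundedVariation t) := by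
  -- Cases 2 and 3 are one statement, since `k 0 = 0` turns `1 < k 1` into the gap condition for `m
  -- = 1`.
  have hgap : 0 < m → k (m - 1) + 1 < k m → CSG.HasBoundedVariation t := fun hm hgap => by
    refine CSG.hasBoundedVariation_of_gap hlam hgap ((ht _).2 ⟨m, le_rfl, rfl⟩) fun j hj hne => ?_
    by_contra hj0
    obtain ⟨i, hi, rfl⟩ := (ht j).1 hj0
    rcases hi.eq_or_lt with rfl | hi
    · exact hne rfl
    · exact absurd hj (not_lt.2 (hk.monotoneOn hi.le (Nat.sub_le m 1) (by omega)))
  refine ⟨fun hpos => ?_, fun hm h₁ => ?_, fun hm => hgap (by omega), fun hm h₁ hpos => ?_⟩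
  · refine CSG.hasBoundedVariation_of_pos hlam fun j => ?_
    by_cases hj : t j = 0
    · simp [hj]
    · obtain ⟨i, hi, rfl⟩ := (ht j).1 hj
      exact (hpos i hi).eq_norm
  · subst hm
    exact hgap one_pos (by simpa [hk0] using h₁)
  · subst hm
    refine CSG.not_hasBoundedVariation_of_linear hlam (fun j hj => ?_)
      ((ht 1).2 ⟨1, le_rfl, h₁.symm⟩) hpos
    by_contra hj0
    obtain ⟨i, hi, rfl⟩ := (ht j).1 hj0
    interval_cases i <;> omega
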